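/- Let $\ell\in\{0,1,2,\dots\}$, $\lambda>0$, $A_1<0$ and $\Lambda\ge-(\ell+\tfrac12)^2$ be real, and put $\mu=\sqrt{\Lambda+(\ell+\tfrac12)^2}$ (nonnegative root). Consider, in atomic units $\hbar=m=1$, the radial Schrödinger equation $$-\tfrac12\psi''(r)+\Big[\frac{\ell(\ell+1)}{2r^2}+\frac{\Lambda}{2r^2}-2\lambda^4A_1r^2\Big]\psi(r)=E\,\psi(r),\qquad r>0,\quad E\in\mathbb R .$$ A bound state of energy $E$ is a nonzero $C^2$ solution $\psi:(0,\infty)\to\mathbb C$ of this equation with $\int_0^\infty|\psi(r)|^2\,dr<\infty$ which, in the case $\mu<1$ (where every solution is square integrable near $0$), is regular at the origin: $\psi(r)=O(r^{\mu+1/2})$ as $r\to0^+$. Then the set of energies $E$ for which a bound state exists is exactly $\{E_k: k=0,1,2,\dots\}$, where $$E_k=4\lambda^2\sqrt{-A_1}\,\Big[k+\tfrac12+\tfrac12\sqrt{\Lambda+(\ell+\tfrac12)^2}\Big].$$ -/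

import Mathlib

open Set Filter Topology MeasureTheory Asymptotics

noncomputable section

namespace SingularOscillator

/-- The effective radial potential `ℓ(ℓ+1)/(2r²) + Λ/(2r²) - 2λ⁴A₁r²`; here `lam` is the scale
parameter `λ` and `Lam` is the strength `Λ` of the singular term. -/
def effectivePotential (l : ℕ) (Lam lam A₁ r : ℝ) : ℝ :=
  (l : ℝ) * ((l : ℝ) + 1) / (2 * r ^ 2) + Lam / (2 * r ^ 2) - 2 * lam ^ 4 * A₁ * r ^ 2

/-- The index `√(Λ + (ℓ + 1/2)²)` of the singularity at the origin: near `r = 0` the solutions of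
the radial Schrödinger equation behave like `r ^ (1/2 ± index)` (like `√r` and `√r log r` if the
index is `0`). -/
def originIndex (l : ℕ) (Lam : ℝ) : ℝ :=
  Real.sqrt (Lam + ((l : ℝ) + 1 / 2) ^ 2)

/-- `ψ` is a bound state of energy `E` on the half line `r > 0` (atomic units `ħ = m = 1`): a
nonzero, square integrable, twice continuously differentiable solution of
`-ψ''/2 + V ψ = E ψ` on `(0, ∞)`. If the index at the origin is less than `1`, every solution is
square integrable near `0`, and the state is moreover required to be regular at the origin, i.e. to
be bounded there by a multiple of `r ^ (1/2 + index)`. -/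
structure IsBoundState (l : ℕ) (Lam lam A₁ E : ℝ) (ψ : ℝ → ℂ) : Prop where
  contDiffOn : ContDiffOn ℝ 2 ψ (Ioi 0)
  schrodinger : ∀ r : ℝ, 0 < r →
    -(1 / 2 : ℂ) * deriv (deriv ψ) r + (effectivePotential l Lam lam A₁ r : ℂ) * ψ r
      = (E : ℂ) * ψ r
  ne_zero : ∃ r : ℝ, 0 < r ∧ ψ r ≠ 0
  memLp : MemLp ψ 2 (volume.restrict (Ioi (0 : ℝ)))
  regular : originIndex l Lam < 1 →
    ψ =O[𝓝[>] (0 : ℝ)] fun r : ℝ => r ^ (originIndex l Lam + 1 / 2)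

/-- The set of bound-state energies. -/
def boundStateEnergies (l : ℕ) (Lam lam A₁ : ℝ) : Set ℝ :=
  {E | ∃ ψ : ℝ → ℂ, IsBoundState l Lam lam A₁ E ψ}

end SingularOscillator

end

/-! With `m` the index at the origin and `w = 2λ²√(-A₁)`, the equation reads `f'' = ((m² - 1/4)/r² +
w²r² - 2e) f`. Its levels `w(m + 1 + 2k)` are attained by `r^(m+1/2) exp(-wr²/2)` times a polynomial
in `r²` (`isRadialSolution_eigenfunction`).

That no other level occurs is shown without asymptotics of special functions. Pair a bound state `f`
with `g_k = r^(m+1/2+2k) exp(-wr²/2)`. The Wronskian of `f` and `g_k` has a derivative that is a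
combination of `f g_k` and `f g_(k-1)`, so once its boundary values vanish the moments `M_k = ∫ f
g_k` satisfy `(2w(m+1+2k) - 2e) M_k = 4k(k+m) M_(k-1)` (`IsRadialSolution.moment_recursion`). If `e`
is not a level, the left factor never vanishes, and the right side is zero at `k = 0`; hence every
`M_k` is zero. So `f g_0` has vanishing moments in `r²`; it is exponentially small in `r²`, hence
zero (`ae_eq_zero_of_moments_eq_zero`). The boundary value at the origin is where square
integrability (`m ≥ 1`) or regularity (`m < 1`) enters. -/

noncomputable section

namespace SingularOscillator

/-! ### Powers with a Gaussian weight -/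

/-- The function `r ^ s * exp (-w r² / 2)`. -/
def gaussPow (w s r : ℝ) : ℝ := r ^ s * Real.exp (-(w / 2) * r ^ 2)

lemma gaussPow_pos (w s : ℝ) {r : ℝ} (hr : 0 < r) : 0 < gaussPow w s r :=
  mul_pos (Real.rpow_pos_of_pos hr s) (Real.exp_pos _)

lemma gaussPow_add (w s t : ℝ) {r : ℝ} (hr : 0 < r) :
    gaussPow w (s + t) r = r ^ t * gaussPow w s r := by
  simp only [gaussPow, Real.rpow_add hr]; ring

lemma gaussPow_add_two_mul_nat (w s : ℝ) (k : ℕ) {r : ℝ} (hr : 0 < r) :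
    gaussPow w (s + 2 * k) r = gaussPow w s r * (r ^ 2) ^ k := by
  rw [gaussPow_add w s _ hr, show (2 * (k : ℝ)) = ((2 * k : ℕ) : ℝ) by push_cast; ring,
    Real.rpow_natCast, pow_mul, mul_comm]

lemma hasDerivAt_gaussPow (w s : ℝ) {r : ℝ} (hr : 0 < r) :
    HasDerivAt (gaussPow w s) (s * gaussPow w (s - 1) r - w * gaussPow w (s + 1) r) r := by
  have h1 : HasDerivAt (fun r : ℝ => r ^ s) (s * r ^ (s - 1)) r :=
    Real.hasDerivAt_rpow_const (Or.inl hr.ne')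
  have h2 : HasDerivAt (fun r : ℝ => Real.exp (-(w / 2) * r ^ 2))
      (Real.exp (-(w / 2) * r ^ 2) * (-(w / 2) * (2 * r))) r := by
    have := ((hasDerivAt_pow 2 r).const_mul (-(w / 2))).exp
    simpa using this
  convert! h1.mul h2 using 1
  simp only [gaussPow, Real.rpow_add hr, Real.rpow_one]
  ring

lemma continuousOn_gaussPow (w s : ℝ) : ContinuousOn (gaussPow w s) (Ioi 0) :=
  fun _ hr => (hasDerivAt_gaussPow w s hr).continuousAt.continuousWithinAt

/-- The derivative of `gaussPow w s` on the half line. -/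
def gaussPowDeriv (w s r : ℝ) : ℝ := s * gaussPow w (s - 1) r - w * gaussPow w (s + 1) r

lemma hasDerivAt_gaussPowDeriv (w s : ℝ) {r : ℝ} (hr : 0 < r) :
    HasDerivAt (gaussPowDeriv w s)
      (s * (s - 1) * gaussPow w (s - 2) r - w * (2 * s + 1) * gaussPow w s r
        + w ^ 2 * r ^ 2 * gaussPow w s r) r := by
  have h1 := (hasDerivAt_gaussPow w (s - 1) hr).const_mul s
  have h2 := (hasDerivAt_gaussPow w (s + 1) hr).const_mul w
  refine (h1.sub h2).congr_deriv ?_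
  have e1 : gaussPow w (s + 1 + 1) r = r ^ 2 * gaussPow w s r := by
    rw [add_assoc, gaussPow_add w s _ hr]; norm_num
  rw [e1, show s - 1 - 1 = s - 2 by ring, show s - 1 + 1 = s by ring,
    show s + 1 - 1 = s by ring]
  ring

lemma continuousOn_gaussPowDeriv (w s : ℝ) : ContinuousOn (gaussPowDeriv w s) (Ioi 0) :=
  fun _ hr => (hasDerivAt_gaussPowDeriv w s hr).continuousAt.continuousWithinAt

lemma memLp_gaussPow {w s : ℝ} (hw : 0 < w) (hs : -(1 / 2) < s) :
    MemLp (gaussPow w s) 2 (volume.restrict (Ioi (0 : ℝ))) := by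
  rw [memLp_two_iff_integrable_sq
    ((continuousOn_gaussPow w s).aestronglyMeasurable measurableSet_Ioi)]
  refine (integrableOn_rpow_mul_exp_neg_mul_sq hw (s := 2 * s) (by linarith)).congr_fun
    (fun r hr => ?_) measurableSet_Ioi
  have hr : 0 < r := hr
  simp only [gaussPow, mul_pow, ← Real.exp_nat_mul, ← Real.rpow_mul_natCast hr.le]
  congr 2
  · push_cast; ring
  · push_cast; ring

lemma integrableOn_mul_gaussPow {f : ℝ → ℝ} (hf : MemLp f 2 (volume.restrict (Ioi (0 : ℝ))))
    {w s : ℝ} (hw : 0 < w) (hs : -(1 / 2) < s) :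
    IntegrableOn (fun r => f r * gaussPow w s r) (Ioi 0) :=
  hf.integrable_mul (memLp_gaussPow hw hs)

/-! ### Determinacy of the moment problem -/

open ProbabilityTheory in
/-- Two finite measures whose moment generating functions are finite near the origin and
all of whose moments agree induce the same distribution. -/
lemma map_eq_of_moments_eq {Ω : Type*} {mΩ : MeasurableSpace Ω} {X : Ω → ℝ} {ν₁ ν₂ : Measure Ω}
    [IsFiniteMeasure ν₁] [IsFiniteMeasure ν₂] (hX : Measurable X)
    (h₁ : 0 ∈ interior (integrableExpSet X ν₁)) (h₂ : 0 ∈ interior (integrableExpSet X ν₂))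
    (h : ∀ n : ℕ, ∫ x, X x ^ n ∂ν₁ = ∫ x, X x ^ n ∂ν₂) :
    ν₁.map X = ν₂.map X := by
  -- A vertical strip on which both complex moment generating functions are analytic. The moments
  -- are their derivatives at `0`, so they agree on the strip, in particular on the imaginary axis,
  -- where they are the characteristic functions.
  set U : Set ℂ := Complex.reLm ⁻¹'
    (interior (integrableExpSet X ν₁) ∩ interior (integrableExpSet X ν₂)) with hU
  have hconv : IsPreconnected U :=
    ((convex_integrableExpSet.interior.inter
      convex_integrableExpSet.interior).linear_preimage Complex.reLm).isPreconnected
  have a₁ : AnalyticOnNhd ℂ (complexMGF X ν₁) U :=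
    analyticOnNhd_complexMGF.mono fun z hz => hz.1
  have a₂ : AnalyticOnNhd ℂ (complexMGF X ν₂) U :=
    analyticOnNhd_complexMGF.mono fun z hz => hz.2
  have h0 : (0 : ℂ) ∈ U := ⟨by simpa using h₁, by simpa using h₂⟩
  have hev : complexMGF X ν₁ =ᶠ[𝓝 0] complexMGF X ν₂ := by
    have p₁ := (a₁ 0 h0).hasFPowerSeriesAt
    have p₂ := (a₂ 0 h0).hasFPowerSeriesAt
    have hp : (fun n => iteratedDeriv n (complexMGF X ν₁) 0 / (n.factorial : ℂ)) =
        fun n => iteratedDeriv n (complexMGF X ν₂) 0 / (n.factorial : ℂ) := by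
      funext n
      rw [iteratedDeriv_complexMGF (by simpa using h₁), iteratedDeriv_complexMGF (by simpa using h₂)]
      have := congrArg (fun x : ℝ => (x : ℂ)) (h n)
      rw [← integral_complex_ofReal, ← integral_complex_ofReal] at this
      simpa using congrArg (· / (n.factorial : ℂ)) this
    rw [hp] at p₁
    have := p₁.sub p₂
    rw [sub_self] at this
    filter_upwards [this.eventually_eq_zero] with z hz
    exact sub_eq_zero.mp hz
  have heq : EqOn (complexMGF X ν₁) (complexMGF X ν₂) U :=
    a₁.eqOn_of_preconnected_of_eventuallyEq a₂ hconv h0 hev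
  have := Measure.isFiniteMeasure_map ν₁ X
  have := Measure.isFiniteMeasure_map ν₂ X
  refine Measure.ext_of_charFun (funext fun t => ?_)
  rw [← complexMGF_mul_I hX.aemeasurable, ← complexMGF_mul_I hX.aemeasurable]
  exact heq ⟨by simpa using h₁, by simpa using h₂⟩

open ProbabilityTheory in
/-- An exponentially small function all of whose moments with respect to an injective variable
vanish is zero almost everywhere. -/
lemma ae_eq_zero_of_moments_eq_zero {ν : Measure ℝ} [SFinite ν] {F X g : ℝ → ℝ} {δ : ℝ}
    (hX : Measurable X) (hg : Measurable g) (hgX : ∀ᵐ r ∂ν, g (X r) = r) (hδ : 0 < δ)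
    (hF : AEMeasurable F ν)
    (hexp : ∀ t < δ, Integrable (fun r => F r * Real.exp (t * X r)) ν)
    (hmom : ∀ n : ℕ, ∫ r, F r * X r ^ n ∂ν = 0) : F =ᵐ[ν] 0 := by
  have hFn : AEMeasurable (fun r => -F r) ν := hF.neg
  have hFi : Integrable F ν := by simpa using hexp 0 hδ
  -- `ENNReal.ofReal` truncates at zero, so `G = F` and `G = -F` yield measures whose densities are
  -- the positive and negative parts of `F`.
  have key : ∀ G : ℝ → ℝ, AEMeasurable G ν → (∀ r, |G r| ≤ |F r|) →
      IsFiniteMeasure (ν.withDensity fun r => ENNReal.ofReal (G r)) ∧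
      0 ∈ interior (integrableExpSet X (ν.withDensity fun r => ENNReal.ofReal (G r))) := by
    intro G hG hGF
    have hGi : Integrable G ν := hFi.mono hG.aestronglyMeasurable (ae_of_all _ hGF)
    refine ⟨isFiniteMeasure_withDensity_ofReal hGi.2, ?_⟩
    rw [mem_interior]
    refine ⟨Iio δ, fun t ht => ?_, isOpen_Iio, hδ⟩
    rw [integrableExpSet, mem_ofPred_eq,
      integrable_withDensity_iff_integrable_smul₀' hG.ennreal_ofReal
        (ae_of_all _ fun _ => ENNReal.ofReal_lt_top)]
    refine (hexp t ht).mono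
      (hG.ennreal_ofReal.ennreal_toReal.smul (by fun_prop)).aestronglyMeasurable (ae_of_all _ fun r => ?_)
    rw [ENNReal.toReal_ofReal', norm_smul, norm_mul]
    gcongr
    refine le_trans ?_ (hGF r)
    rw [Real.norm_eq_abs]
    refine abs_le_abs_of_nonneg (le_max_right _ _) ?_ |>.trans (le_of_eq (abs_abs _))
    exact max_le (le_abs_self _) (abs_nonneg _)
  obtain ⟨i₁, e₁⟩ := key F hF fun _ => le_rfl
  obtain ⟨i₂, e₂⟩ := key (fun r => -F r) hFn fun _ => (abs_neg _).le
  have hm : ∀ n : ℕ, ∫ r, X r ^ n ∂(ν.withDensity fun r => ENNReal.ofReal (F r)) =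
      ∫ r, X r ^ n ∂(ν.withDensity fun r => ENNReal.ofReal (-F r)) := by
    intro n
    have j₁ := integrable_pow_of_mem_interior_integrableExpSet e₁ n
    have j₂ := integrable_pow_of_mem_interior_integrableExpSet e₂ n
    rw [integrable_withDensity_iff_integrable_smul₀' hF.ennreal_ofReal
        (ae_of_all _ fun _ => ENNReal.ofReal_lt_top)] at j₁
    rw [integrable_withDensity_iff_integrable_smul₀' hFn.ennreal_ofReal
        (ae_of_all _ fun _ => ENNReal.ofReal_lt_top)] at j₂
    rw [integral_withDensity_eq_integral_toReal_smul₀ hF.ennreal_ofReal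
        (ae_of_all _ fun _ => ENNReal.ofReal_lt_top),
      integral_withDensity_eq_integral_toReal_smul₀ hFn.ennreal_ofReal
        (ae_of_all _ fun _ => ENNReal.ofReal_lt_top), ← sub_eq_zero]
    rw [← hmom n, ← integral_sub j₁ j₂]
    refine integral_congr_ae (ae_of_all _ fun r => ?_)
    simp only [ENNReal.toReal_ofReal', smul_eq_mul, ← sub_mul]
    congr 1
    rcases le_total 0 (F r) with h | h
    · simp [h]
    · simp [h]
  have hmap := map_eq_of_moments_eq hX e₁ e₂ hm
  -- The left inverse `g` recovers each measure from its image under `X`.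
  have hback : ∀ G : ℝ → ℝ, ((ν.withDensity fun r => ENNReal.ofReal (G r)).map X).map g =
      ν.withDensity fun r => ENNReal.ofReal (G r) := by
    intro G
    rw [Measure.map_map hg hX]
    conv_rhs => rw [← Measure.map_id (μ := ν.withDensity fun r => ENNReal.ofReal (G r))]
    exact Measure.map_congr ((withDensity_absolutelyContinuous _ _).ae_le hgX)
  have heq : (ν.withDensity fun r => ENNReal.ofReal (F r)) =
      ν.withDensity fun r => ENNReal.ofReal (-F r) := by
    rw [← hback F, ← hback fun r => -F r, hmap]
  have hfin : ∫⁻ r, ENNReal.ofReal (F r) ∂ν ≠ ⊤ := by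
    have := i₁.measure_univ_lt_top
    rw [withDensity_apply _ MeasurableSet.univ, Measure.restrict_univ] at this
    exact this.ne
  have := (withDensity_eq_iff hF.ennreal_ofReal hFn.ennreal_ofReal hfin).mp heq
  filter_upwards [this] with r hr
  rcases le_total 0 (F r) with h | h
  · rw [ENNReal.ofReal_of_nonpos (neg_nonpos.mpr h), ENNReal.ofReal_eq_zero] at hr
    exact le_antisymm hr h
  · rw [ENNReal.ofReal_of_nonpos h, eq_comm, ENNReal.ofReal_eq_zero] at hr
    exact le_antisymm h (by simpa using hr)

/-! ### Boundary values at infinity -/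

lemma nonpos_of_tendsto_atTop_of_integrableOn {u v W : ℝ → ℝ} {c : ℝ} (hu : IntegrableOn u (Ioi 1))
    (hv : IntegrableOn v (Ioi 1)) (hvc : ContinuousOn v (Ioi 0))
    (hd : ∀ r, 0 < r → HasDerivAt u (W r + v r) r) (hW : Tendsto W atTop (𝓝 c)) : c ≤ 0 := by
  by_contra! hc
  obtain ⟨R, hR1, hR⟩ : ∃ R : ℝ, 1 < R ∧ ∀ r, R ≤ r → c / 2 < W r := by
    obtain ⟨R, hR⟩ := eventually_atTop.mp (hW.eventually (lt_mem_nhds (half_lt_self hc)))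
    exact ⟨max R 2, by simp, fun r hr => hR r ((le_max_left _ _).trans hr)⟩
  have hvR : IntegrableOn v (Ioi R) := hv.mono_set (Ioi_subset_Ioi hR1.le)
  set C := ∫ r in Ioi R, |v r| with hC
  have hVd : ∀ r, R ≤ r → HasDerivAt (fun x => ∫ y in R..x, v y) (v r) r := by
    intro r hr
    have hsub : uIcc R r ⊆ Ioi 0 := by
      rw [uIcc_of_le hr]; exact fun x hx => lt_of_lt_of_le (by linarith) hx.1
    have hr0 : r ∈ Ioi (0 : ℝ) := mem_Ioi.mpr (by linarith)
    exact intervalIntegral.integral_hasDerivAt_right (hvc.mono hsub).intervalIntegrable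
      (hvc.stronglyMeasurableAtFilter isOpen_Ioi r hr0) (hvc.continuousAt (Ioi_mem_nhds hr0))
  have hVb : ∀ r, R ≤ r → -C ≤ ∫ y in R..r, v y := by
    intro r hr
    rw [intervalIntegral.integral_of_le hr]
    have h1 : |∫ y in Ioc R r, v y| ≤ ∫ y in Ioc R r, |v y| := abs_integral_le_integral_abs
    have h2 : ∫ y in Ioc R r, |v y| ≤ C :=
      setIntegral_mono_set hvR.abs (ae_of_all _ fun _ => abs_nonneg _)
        (Ioc_subset_Ioi_self.eventuallyLE)
    linarith [neg_abs_le (∫ y in Ioc R r, v y)]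
  -- Past `R` the part `W` of the derivative exceeds `c / 2`, while `v` contributes at least `-C`:
  -- `u` grows linearly and cannot be integrable.
  have hlow : ∀ r, R ≤ r → u R + c / 2 * (r - R) - C ≤ u r := by
    intro r hr
    have hd' : ∀ x ∈ Ici R, HasDerivAt (fun x => u x - ∫ y in R..x, v y) (W x) x := fun x hx => by
      have := (hd x (by linarith [mem_Ici.mp hx])).sub (hVd x hx)
      exact this.congr_deriv (by ring)
    have := (convex_Ici R).mul_sub_le_image_sub_of_le_deriv (f := fun x => u x - ∫ y in R..x, v y)
      (C := c / 2) (fun x hx => (hd' x hx).continuousAt.continuousWithinAt)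
      (fun x hx => (hd' x (interior_subset hx)).differentiableAt.differentiableWithinAt)
      (fun x hx => by
        rw [(hd' x (interior_subset hx)).deriv]; exact (hR x (interior_subset hx)).le)
      R self_mem_Ici r hr hr
    simp only [intervalIntegral.integral_same] at this
    linarith [hVb r hr]
  obtain ⟨R', hR'⟩ : ∃ R', R ≤ R' ∧ ∀ r, R' ≤ r → 1 ≤ u r := by
    refine ⟨max R (R + (1 + C - u R) / (c / 2)), le_max_left _ _, fun r hr => ?_⟩
    refine le_trans ?_ (hlow r ((le_max_left _ _).trans hr))
    have h := (le_max_right _ _).trans hr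
    have : (1 + C - u R) / (c / 2) ≤ r - R := by linarith
    rw [div_le_iff₀ (by positivity)] at this
    linarith
  have h1 : IntegrableOn (fun _ : ℝ => (1 : ℝ)) (Ioi R') := by
    refine (hu.mono_set (Ioi_subset_Ioi (by linarith [hR'.1]))).mono'
      aestronglyMeasurable_const ?_
    filter_upwards [ae_restrict_mem measurableSet_Ioi] with r hr
    simpa using hR'.2 r (le_of_lt hr)
  simp [integrableOn_const_iff] at h1

/-- If `u` is integrable at infinity and its derivative is the sum of an integrable function
and a convergent one, then the limit of the latter is `0`. -/
lemma eq_zero_of_tendsto_atTop_of_integrableOn {u v W : ℝ → ℝ} {c : ℝ} (hu : IntegrableOn u (Ioi 1))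
    (hv : IntegrableOn v (Ioi 1)) (hvc : ContinuousOn v (Ioi 0))
    (hd : ∀ r, 0 < r → HasDerivAt u (W r + v r) r) (hW : Tendsto W atTop (𝓝 c)) : c = 0 := by
  refine le_antisymm (nonpos_of_tendsto_atTop_of_integrableOn hu hv hvc hd hW) ?_
  have := nonpos_of_tendsto_atTop_of_integrableOn hu.neg hv.neg hvc.neg
    (W := fun r => -W r) (fun r hr => (hd r hr).neg.congr_deriv (by simp; ring)) hW.neg
  linarith

/-! ### Boundary values at the origin -/

/-- The Wronskian of `f` (with derivative `f'`) and `gaussPow w s`. -/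
def wronskian (f f' : ℝ → ℝ) (w s r : ℝ) : ℝ := f' r * gaussPow w s r - f r * gaussPowDeriv w s r

lemma hasDerivAt_div_gaussPow {f f' : ℝ → ℝ} (w s : ℝ) {r : ℝ} (hr : 0 < r)
    (hf : HasDerivAt f (f' r) r) :
    HasDerivAt (fun r => f r / gaussPow w s r) (wronskian f f' w s r / gaussPow w s r ^ 2) r :=
  hf.div (hasDerivAt_gaussPow w s hr) (gaussPow_pos w s hr).ne'

lemma gaussPow_le_rpow {w : ℝ} (hw : 0 < w) (s : ℝ) {r : ℝ} (hr : 0 < r) :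
    gaussPow w s r ≤ r ^ s := by
  refine mul_le_of_le_one_right (Real.rpow_nonneg hr.le s) ?_
  rw [Real.exp_le_one_iff]
  nlinarith [sq_nonneg r]

lemma div_rpow_le_deriv_div_gaussPow {f f' : ℝ → ℝ} {w : ℝ} (hw : 0 < w) (s : ℝ) {r c : ℝ}
    (hr : 0 < r) (hc : 0 ≤ c) (h : c ≤ wronskian f f' w s r) :
    c / (r ^ s) ^ 2 ≤ wronskian f f' w s r / gaussPow w s r ^ 2 := by
  have := gaussPow_pos w s hr
  have := gaussPow_le_rpow hw s hr
  have := hc.trans h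
  gcongr

/-- If `c > 0`, the quotient `f / gaussPow w s` has derivative at least `(c/2) r^(-2s)` near `0`.
The mean value theorem on `[r, 2r]` then bounds `|f r| + |f (2r)|` below by a multiple of `r^(1-s) ≥
r^(-1/2)`, whose square is not integrable at `0`. -/
lemma nonpos_of_tendsto_wronskian_of_memLp {f f' : ℝ → ℝ} {w s c : ℝ} (hw : 0 < w)
    (hs : 3 / 2 ≤ s) (hf : ∀ r, 0 < r → HasDerivAt f (f' r) r)
    (hL : MemLp f 2 (volume.restrict (Ioi (0 : ℝ))))
    (hW : Tendsto (wronskian f f' w s) (𝓝[>] 0) (𝓝 c)) : c ≤ 0 := by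
  by_contra! hc
  obtain ⟨δ, hδ, hδ'⟩ : ∃ δ > 0, ∀ r, 0 < r → r < δ → c / 2 < wronskian f f' w s r := by
    have := hW.eventually (lt_mem_nhds (half_lt_self hc))
    obtain ⟨δ, hδ, h⟩ := mem_nhdsGT_iff_exists_Ioo_subset.mp this
    exact ⟨δ, hδ, fun r h1 h2 => h ⟨h1, h2⟩⟩
  set ε := min (δ / 2) (1 / 2) with hε
  have hε0 : 0 < ε := by positivity
  set κ := Real.exp (-(w / 2)) with hκ
  have hκ0 : 0 < κ := Real.exp_pos _
  have hlow : ∀ r, 0 < r → r ≤ 1 → κ * r ^ s ≤ gaussPow w s r := by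
    intro r hr hr1
    rw [gaussPow, mul_comm]
    have : Real.exp (-(w / 2)) ≤ Real.exp (-(w / 2) * r ^ 2) := by
      rw [Real.exp_le_exp]; nlinarith [pow_le_one₀ hr.le hr1 (n := 2)]
    gcongr
  -- `2 ^ s` comes from replacing the intermediate point by `2 * r`, and `κ` bounds the Gaussian
  -- factor below on `(0, 1]`.
  set A := c / 2 / (2 ^ s) ^ 2 * κ with hA
  have hA0 : 0 < A := by positivity
  have hbound : ∀ r, 0 < r → r < ε → A * r ^ (-(1 / 2) : ℝ) ≤ |f r| + |f (2 * r)| := by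
    intro r hr hrε
    have h1 : r < δ / 2 := hrε.trans_le (min_le_left _ _)
    have h2 : r < 1 / 2 := hrε.trans_le (min_le_right _ _)
    obtain ⟨ξ, hξ, he⟩ := exists_hasDerivAt_eq_slope (fun r => f r / gaussPow w s r)
      (fun r => wronskian f f' w s r / gaussPow w s r ^ 2) (show r < 2 * r by linarith)
      (fun x hx => (hasDerivAt_div_gaussPow w s (hr.trans_le hx.1)
        (hf x (hr.trans_le hx.1))).continuousAt.continuousWithinAt)
      (fun x hx => hasDerivAt_div_gaussPow w s (hr.trans hx.1) (hf x (hr.trans hx.1)))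
    have hξ0 : 0 < ξ := hr.trans hξ.1
    have h3 := div_rpow_le_deriv_div_gaussPow hw s hξ0 (half_pos hc).le
      (hδ' ξ hξ0 (by linarith [hξ.2])).le
    have h4 : c / 2 / ((2 * r) ^ s) ^ 2 ≤ c / 2 / (ξ ^ s) ^ 2 := by
      have : ξ ^ s ≤ (2 * r) ^ s := Real.rpow_le_rpow hξ0.le hξ.2.le (by linarith)
      have := Real.rpow_pos_of_pos hξ0 s
      gcongr
    have h5 := h4.trans h3
    rw [he, show 2 * r - r = r by ring, le_div_iff₀ hr] at h5
    have hrs := Real.rpow_pos_of_pos hr s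
    have h6 : ∀ x, r ≤ x → x ≤ 1 → |f x / gaussPow w s x| ≤ |f x| / (κ * r ^ s) := by
      intro x hx hx1
      have hx0 := hr.trans_le hx
      rw [abs_div, abs_of_pos (gaussPow_pos w s hx0)]
      have : κ * r ^ s ≤ gaussPow w s x := by
        refine le_trans ?_ (hlow x hx0 hx1)
        have := Real.rpow_le_rpow hr.le hx (show 0 ≤ s by linarith)
        gcongr
      gcongr
    have h7 : f (2 * r) / gaussPow w s (2 * r) - f r / gaussPow w s r ≤
        (|f r| + |f (2 * r)|) / (κ * r ^ s) := by
      rw [add_div]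
      have := h6 r le_rfl (by linarith)
      have := h6 (2 * r) (by linarith) (by linarith)
      linarith [le_abs_self (f (2 * r) / gaussPow w s (2 * r)), neg_abs_le (f r / gaussPow w s r)]
    have h8 := h5.trans h7
    rw [le_div_iff₀ (by positivity), Real.mul_rpow (by norm_num) hr.le] at h8
    refine le_trans ?_ h8
    have h9 : c / 2 / (2 ^ s * r ^ s) ^ 2 * r * (κ * r ^ s) = A * (r / r ^ s) := by
      rw [hA]; field_simp
    rw [h9]
    have h10 : r / r ^ s = r ^ (1 - s) := by rw [Real.rpow_sub hr, Real.rpow_one]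
    rw [h10]
    have := Real.rpow_le_rpow_of_exponent_ge hr (by linarith) (show 1 - s ≤ -(1 / 2) by linarith)
    gcongr
  have hsq : IntegrableOn (fun r => f r ^ 2) (Ioi 0) := hL.integrable_sq
  have hsq2 : IntegrableOn (fun r => f (2 * r) ^ 2) (Ioi 0) := by
    have := (integrableOn_Ioi_comp_mul_left_iff (fun r => f r ^ 2) 0 (show (0 : ℝ) < 2 by norm_num))
    rw [mul_zero] at this
    exact this.mpr hsq
  have hint : IntegrableOn (fun r : ℝ => r ^ (-1 : ℝ)) (Ioo 0 ε) := by
    have hsum : IntegrableOn (fun r => 2 / A ^ 2 * (f r ^ 2 + f (2 * r) ^ 2)) (Ioo 0 ε) :=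
      IntegrableOn.mono_set (Integrable.const_mul (hsq.add hsq2) _) Ioo_subset_Ioi_self
    refine hsum.mono' (by fun_prop) ?_
    filter_upwards [ae_restrict_mem measurableSet_Ioo] with r hr
    have hr0 : 0 < r := hr.1
    rw [Real.norm_of_nonneg (Real.rpow_nonneg hr0.le _)]
    have h1 := hbound r hr.1 hr.2
    have h2 : r ^ (-1 : ℝ) = (r ^ (-(1 / 2) : ℝ)) ^ 2 := by
      rw [← Real.rpow_mul_natCast hr0.le]; norm_num
    have h3 : (A * r ^ (-(1 / 2) : ℝ)) ^ 2 ≤ (|f r| + |f (2 * r)|) ^ 2 := by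
      have := Real.rpow_pos_of_pos hr0 (-(1 / 2))
      gcongr
    rw [h2, div_mul_eq_mul_div, le_div_iff₀ (by positivity)]
    have h4 := add_sq_le (a := |f r|) (b := |f (2 * r)|)
    rw [sq_abs, sq_abs] at h4
    nlinarith
  rw [intervalIntegral.integrableOn_Ioo_rpow_iff hε0] at hint
  exact lt_irrefl _ hint

/-- If `c > 0`, then since `r^(2s) ≤ r` near `0` the derivative of `f / gaussPow w s` is at least
`(c/2) / r`. The quotient tends to `-∞` at least logarithmically, but regularity keeps it bounded.
-/
lemma nonpos_of_tendsto_wronskian_of_isBigO {f f' : ℝ → ℝ} {w s c : ℝ} (hw : 0 < w)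
    (hs : 1 / 2 ≤ s) (hf : ∀ r, 0 < r → HasDerivAt f (f' r) r)
    (hO : f =O[𝓝[>] (0 : ℝ)] fun r : ℝ => r ^ s)
    (hW : Tendsto (wronskian f f' w s) (𝓝[>] 0) (𝓝 c)) : c ≤ 0 := by
  by_contra! hc
  obtain ⟨δ, hδ, hδ'⟩ : ∃ δ > 0, ∀ r, 0 < r → r < δ → c / 2 < wronskian f f' w s r := by
    have := hW.eventually (lt_mem_nhds (half_lt_self hc))
    obtain ⟨δ, hδ, h⟩ := mem_nhdsGT_iff_exists_Ioo_subset.mp this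
    exact ⟨δ, hδ, fun r h1 h2 => h ⟨h1, h2⟩⟩
  set ε := min (δ / 2) (1 / 2) with hε
  have hε0 : 0 < ε := by positivity
  have hεδ : ε < δ := (min_le_left _ _).trans_lt (half_lt_self hδ)
  have hε1 : ε ≤ 1 / 2 := min_le_right _ _
  have hd : ∀ x, 0 < x → HasDerivAt (fun r => f r / gaussPow w s r - c / 2 * Real.log r)
      (wronskian f f' w s x / gaussPow w s x ^ 2 - c / 2 * x⁻¹) x := fun x hx =>
    (hasDerivAt_div_gaussPow w s hx (hf x hx)).sub ((Real.hasDerivAt_log hx.ne').const_mul _)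
  have hmono : MonotoneOn (fun r => f r / gaussPow w s r - c / 2 * Real.log r) (Ioc 0 ε) := by
    refine monotoneOn_of_deriv_nonneg (convex_Ioc 0 ε)
      (fun x hx => (hd x hx.1).continuousAt.continuousWithinAt)
      (fun x hx => (hd x (interior_subset hx).1).differentiableAt.differentiableWithinAt)
      fun x hx => ?_
    have hx := interior_subset hx
    have hx0 : 0 < x := hx.1
    have hx1 : x ≤ ε := hx.2
    rw [(hd x hx0).deriv]
    have h1 := div_rpow_le_deriv_div_gaussPow hw s hx0 (half_pos hc).le
      (hδ' x hx0 (by linarith)).le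
    have h2 : (x ^ s) ^ 2 ≤ x := by
      rw [← Real.rpow_mul_natCast hx0.le]
      have := Real.rpow_le_rpow_of_exponent_ge hx0 (by linarith)
        (show 1 ≤ s * (2 : ℕ) by push_cast; linarith)
      simpa using this
    have h3 : c / 2 * x⁻¹ ≤ c / 2 / (x ^ s) ^ 2 := by
      have := Real.rpow_pos_of_pos hx0 s
      rw [← div_eq_mul_inv]
      gcongr
    linarith
  obtain ⟨K, hK⟩ := hO.bound
  have hlog : Tendsto (fun r => c / 2 * Real.log r) (𝓝[>] 0) atBot :=
    Real.tendsto_log_nhdsGT_zero.const_mul_atBot (half_pos hc)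
  set B := f ε / gaussPow w s ε - c / 2 * Real.log ε with hB
  have hIoc : ∀ᶠ r in 𝓝[>] (0 : ℝ), r ∈ Ioc 0 ε := Ioc_mem_nhdsGT hε0
  obtain ⟨r, hr, hrl, hrK⟩ :=
    (hIoc.and ((hlog.eventually_lt_atBot (-(|K| * Real.exp (w / 2)) - B)).and hK)).exists
  have hr0 : 0 < r := hr.1
  have h1 : f r / gaussPow w s r - c / 2 * Real.log r ≤ B :=
    hmono hr (right_mem_Ioc.mpr hε0) hr.2
  have hrs := Real.rpow_pos_of_pos hr0 s
  have h2 : |f r / gaussPow w s r| ≤ |K| * Real.exp (w / 2) := by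
    rw [abs_div, abs_of_pos (gaussPow_pos w s hr0), div_le_iff₀ (gaussPow_pos w s hr0)]
    rw [Real.norm_eq_abs, Real.norm_of_nonneg hrs.le] at hrK
    have h3 : 1 ≤ Real.exp (w / 2) * Real.exp (-(w / 2) * r ^ 2) := by
      rw [← Real.exp_add, Real.one_le_exp_iff]
      have : r ≤ 1 := by linarith [hr.2]
      nlinarith [pow_le_one₀ hr0.le this (n := 2)]
    have h4 : K * r ^ s ≤ |K| * r ^ s := by gcongr; exact le_abs_self K
    calc |f r| ≤ |K| * r ^ s := hrK.trans h4
      _ ≤ |K| * r ^ s * (Real.exp (w / 2) * Real.exp (-(w / 2) * r ^ 2)) :=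
          le_mul_of_one_le_right (by positivity) h3
      _ = |K| * Real.exp (w / 2) * gaussPow w s r := by rw [gaussPow]; ring
  linarith [neg_abs_le (f r / gaussPow w s r)]

/-- A limit at the origin of the Wronskian with the regular solution vanishes. -/
lemma eq_zero_of_tendsto_wronskian {f f' : ℝ → ℝ} {w s c : ℝ} (hw : 0 < w)
    (hs : 1 / 2 ≤ s) (hf : ∀ r, 0 < r → HasDerivAt f (f' r) r)
    (hL : MemLp f 2 (volume.restrict (Ioi (0 : ℝ))))
    (hO : s < 3 / 2 → f =O[𝓝[>] (0 : ℝ)] fun r : ℝ => r ^ s)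
    (hW : Tendsto (wronskian f f' w s) (𝓝[>] 0) (𝓝 c)) : c = 0 := by
  have hWn : Tendsto (wronskian (fun r => -f r) (fun r => -f' r) w s) (𝓝[>] 0) (𝓝 (-c)) :=
    hW.neg.congr fun r => by simp only [wronskian]; ring
  have hfn : ∀ r, 0 < r → HasDerivAt (fun r => -f r) (-f' r) r := fun r hr => (hf r hr).neg
  refine le_antisymm ?_ (neg_nonpos.mp ?_)
  · rcases lt_or_ge s (3 / 2) with h | h
    · exact nonpos_of_tendsto_wronskian_of_isBigO hw hs hf (hO h) hW
    · exact nonpos_of_tendsto_wronskian_of_memLp hw h hf hL hW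
  · rcases lt_or_ge s (3 / 2) with h | h
    · exact nonpos_of_tendsto_wronskian_of_isBigO hw hs hfn (hO h).neg_left hWn
    · exact nonpos_of_tendsto_wronskian_of_memLp hw h hfn hL.neg hWn

/-! ### Moments of a radial solution -/

section RadialSolution

/-- The real radial equation `f'' = ((m² - 1/4) / r² + w² r² - 2 e) f` on the half line. -/
structure IsRadialSolution (m w e : ℝ) (f f' : ℝ → ℝ) : Prop where
  hasDerivAt : ∀ r, 0 < r → HasDerivAt f (f' r) r
  hasDerivAt_deriv : ∀ r, 0 < r →
    HasDerivAt f' (((m ^ 2 - 1 / 4) / r ^ 2 + w ^ 2 * r ^ 2 - 2 * e) * f r) r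

variable {m w e : ℝ} {f f' : ℝ → ℝ}

lemma IsRadialSolution.continuousOn (h : IsRadialSolution m w e f f') :
    ContinuousOn f (Ioi 0) :=
  fun r hr => (h.hasDerivAt r hr).continuousAt.continuousWithinAt

/-- In `f'' g - f g''` the terms in `w² r²` cancel, and the exponent `s = m + 1/2 + 2k` makes
`s(s-1) - (m² - 1/4) = 4k(k+m)`. -/
lemma IsRadialSolution.hasDerivAt_wronskian (h : IsRadialSolution m w e f f') (k : ℕ) {r : ℝ}
    (hr : 0 < r) :
    HasDerivAt (wronskian f f' w (m + 1 / 2 + 2 * k))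
      ((2 * w * (m + 1 + 2 * k) - 2 * e) * (f r * gaussPow w (m + 1 / 2 + 2 * k) r)
        - 4 * k * (k + m) * (f r * gaussPow w (m + 1 / 2 + 2 * k - 2) r)) r := by
  set s := m + 1 / 2 + 2 * (k : ℝ) with hs
  have h1 := ((h.hasDerivAt_deriv r hr).mul (hasDerivAt_gaussPow w s hr)).sub
    ((h.hasDerivAt r hr).mul (hasDerivAt_gaussPowDeriv w s hr))
  refine h1.congr_deriv ?_
  have e1 : gaussPow w s r = r ^ 2 * gaussPow w (s - 2) r := by
    have := gaussPow_add w (s - 2) 2 hr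
    rw [sub_add_cancel] at this
    rw [this]; norm_num
  have e2 : (m ^ 2 - 1 / 4) / r ^ 2 * gaussPow w s r = (m ^ 2 - 1 / 4) * gaussPow w (s - 2) r := by
    rw [e1]; field_simp
  have e3 : gaussPowDeriv w s r = s * gaussPow w (s - 1) r - w * gaussPow w (s + 1) r := rfl
  rw [e3]
  have e4 : (m ^ 2 - 1 / 4) - s * (s - 1) = -(4 * k * (k + m)) := by rw [hs]; ring
  have e5 : w * (2 * s + 1) = 2 * w * (m + 1 + 2 * k) := by rw [hs]; ring
  linear_combination f r * e2 + f r * gaussPow w (s - 2) r * e4 + f r * gaussPow w s r * e5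

/-- The moments of a square integrable solution that is regular at the origin satisfy a two-term
recursion. -/
lemma IsRadialSolution.moment_recursion (h : IsRadialSolution m w e f f') (hm : 0 ≤ m) (hw : 0 < w)
    (hL : MemLp f 2 (volume.restrict (Ioi (0 : ℝ))))
    (hO : m < 1 → f =O[𝓝[>] (0 : ℝ)] fun r : ℝ => r ^ (m + 1 / 2)) (k : ℕ) :
    (2 * w * (m + 1 + 2 * k) - 2 * e) * ∫ r in Ioi 0, f r * gaussPow w (m + 1 / 2 + 2 * k) r =
      4 * k * (k + m) * ∫ r in Ioi 0, f r * gaussPow w (m + 1 / 2 + 2 * k - 2) r := by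
  set s := m + 1 / 2 + 2 * (k : ℝ) with hs
  have hk : (0 : ℝ) ≤ k := k.cast_nonneg
  have hs0 : 1 / 2 ≤ s := by rw [hs]; linarith
  have i1 : IntegrableOn (fun r => f r * gaussPow w s r) (Ioi 0) :=
    integrableOn_mul_gaussPow hL hw (by linarith)
  have i1' := Integrable.const_mul i1 (2 * w * (m + 1 + 2 * k) - 2 * e)
  have i2' : IntegrableOn (fun r => 4 * k * (k + m) * (f r * gaussPow w (s - 2) r)) (Ioi 0) := by
    -- For `k = 0` the integral with exponent `s - 2` may diverge, but its coefficient is zero.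
    rcases k.eq_zero_or_pos with rfl | hk1
    · simp
    · have : (1 : ℝ) ≤ k := by exact_mod_cast hk1
      exact Integrable.const_mul (integrableOn_mul_gaussPow hL hw (by rw [hs]; linarith)) _
  have hd := fun r (hr : 0 < r) => h.hasDerivAt_wronskian k hr
  rw [← hs] at hd
  set g := fun r => (2 * w * (m + 1 + 2 * k) - 2 * e) * (f r * gaussPow w s r)
        - 4 * k * (k + m) * (f r * gaussPow w (s - 2) r) with hg
  have ig : IntegrableOn g (Ioi 0) := Integrable.sub i1' i2'
  -- The Wronskian `W` has a limit because its derivative is integrable. The limit is zero because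
  -- `(f g)' = W + 2 f g'` with `f g` and `f g'` integrable on `(1, ∞)`.
  have htop : Tendsto (wronskian f f' w s) atTop (𝓝 0) := by
    have hlim := tendsto_limUnder_of_hasDerivAt_of_integrableOn_Ioi
      (a := 1) (f := wronskian f f' w s) (f' := g)
      (fun r hr => hd r (one_pos.trans hr)) (ig.mono_set (Ioi_subset_Ioi zero_le_one))
    have i3 : IntegrableOn (fun r => f r * gaussPow w (s + 1) r) (Ioi 1) :=
      (integrableOn_mul_gaussPow hL hw (by linarith)).mono_set (Ioi_subset_Ioi zero_le_one)
    -- The exponent `s - 1` may equal `-1/2`, the excluded endpoint at the origin; beyond `1` the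
    -- power `s` dominates it.
    have i4 : IntegrableOn (fun r => f r * gaussPow w (s - 1) r) (Ioi 1) := by
      refine Integrable.mono (i1.mono_set (Ioi_subset_Ioi zero_le_one)) ?_ ?_
      · exact ((h.continuousOn.mul (continuousOn_gaussPow w _)).mono
          (Ioi_subset_Ioi zero_le_one)).aestronglyMeasurable measurableSet_Ioi
      · filter_upwards [ae_restrict_mem measurableSet_Ioi] with r hr
        have hr1 : 1 ≤ r := le_of_lt hr
        have hr0 : 0 < r := one_pos.trans_le hr1
        rw [norm_mul, norm_mul, Real.norm_of_nonneg (gaussPow_pos w _ hr0).le,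
          Real.norm_of_nonneg (gaussPow_pos w _ hr0).le]
        have : gaussPow w (s - 1) r ≤ gaussPow w s r := by
          unfold gaussPow
          gcongr
          linarith
        gcongr
    have hzero := eq_zero_of_tendsto_atTop_of_integrableOn (u := fun r => f r * gaussPow w s r)
      (v := fun r => 2 * (f r * gaussPowDeriv w s r)) (W := wronskian f f' w s)
      (i1.mono_set (Ioi_subset_Ioi zero_le_one))
      (by
        have := Integrable.const_mul (Integrable.sub (Integrable.const_mul i4 s)
          (Integrable.const_mul i3 w)) 2
        refine this.congr (ae_of_all _ fun r => ?_)
        simp only [gaussPowDeriv, Pi.sub_apply]; ring)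
      (continuousOn_const.mul (h.continuousOn.mul (continuousOn_gaussPowDeriv w s)))
      (fun r hr => ((h.hasDerivAt r hr).mul (hasDerivAt_gaussPow w s hr)).congr_deriv (by
        simp only [wronskian, gaussPowDeriv]; ring)) hlim
    rwa [hzero] at hlim
  have hcover : Tendsto (fun r => ∫ x in Ioi r, g x) (𝓝[>] 0) (𝓝 (∫ x in Ioi 0, g x)) := by
    have hc : AECover (volume.restrict (Ioi (0 : ℝ))) (𝓝[>] 0) fun r : ℝ => Ioi r :=
      aecover_Ioi_of_Ioi (tendsto_id.mono_left nhdsWithin_le_nhds)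
    have := hc.integral_tendsto_of_countably_generated ig
    refine this.congr' ?_
    filter_upwards [self_mem_nhdsWithin] with r hr
    rw [Measure.restrict_restrict measurableSet_Ioi,
      inter_eq_left.mpr (Ioi_subset_Ioi (le_of_lt hr))]
  have hbot : Tendsto (wronskian f f' w s) (𝓝[>] 0) (𝓝 (-∫ x in Ioi 0, g x)) := by
    refine hcover.neg.congr' ?_
    filter_upwards [self_mem_nhdsWithin] with r hr
    have hr : 0 < r := hr
    rw [integral_Ioi_of_hasDerivAt_of_tendsto' (f := wronskian f f' w s) (m := 0)
      (fun x hx => hd x (hr.trans_le hx)) (ig.mono_set (Ioi_subset_Ioi hr.le)) htop]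
    ring
  have hzero : ∫ x in Ioi 0, g x = 0 := by
    rw [← neg_eq_zero]
    refine eq_zero_of_tendsto_wronskian hw hs0 h.hasDerivAt hL (fun hlt => ?_) hbot
    have hk0 : k = 0 := by
      by_contra hne
      have : (1 : ℝ) ≤ k := by exact_mod_cast Nat.one_le_iff_ne_zero.mpr hne
      linarith
    subst hk0
    have := hO (by rw [hs] at hlt; push_cast at hlt; linarith)
    simpa [hs] using this
  rw [hg, integral_sub i1' i2', integral_const_mul, integral_const_mul] at hzero
  linarith

/-- Away from the oscillator levels the only square integrable regular solution is zero. -/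
lemma IsRadialSolution.eq_zero (h : IsRadialSolution m w e f f') (hm : 0 ≤ m) (hw : 0 < w)
    (hL : MemLp f 2 (volume.restrict (Ioi (0 : ℝ))))
    (hO : m < 1 → f =O[𝓝[>] (0 : ℝ)] fun r : ℝ => r ^ (m + 1 / 2))
    (he : ∀ k : ℕ, e ≠ w * (m + 1 + 2 * k)) : ∀ r, 0 < r → f r = 0 := by
  have hmom : ∀ k : ℕ, ∫ r in Ioi 0, f r * gaussPow w (m + 1 / 2 + 2 * k) r = 0 := by
    intro k
    have hne : 2 * w * (m + 1 + 2 * k) - 2 * e ≠ 0 := fun h0 => he k (by linarith)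
    induction k with
    | zero =>
      have := h.moment_recursion hm hw hL hO 0
      rw [show (4 : ℝ) * ((0 : ℕ) : ℝ) * (((0 : ℕ) : ℝ) + m) = 0 by simp, zero_mul,
        mul_eq_zero] at this
      exact this.resolve_left hne
    | succ k ih =>
      have := h.moment_recursion hm hw hL hO (k + 1)
      rw [show m + 1 / 2 + 2 * ((k + 1 : ℕ) : ℝ) - 2 = m + 1 / 2 + 2 * k by push_cast; ring,
        ih fun h0 => he k (by linarith), mul_zero, mul_eq_zero] at this
      exact this.resolve_left hne
  have hcont : ContinuousOn (fun r => f r * gaussPow w (m + 1 / 2) r) (Ioi 0) :=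
    h.continuousOn.mul (continuousOn_gaussPow w _)
  have hae : (fun r => f r * gaussPow w (m + 1 / 2) r) =ᵐ[volume.restrict (Ioi 0)] 0 := by
    -- The weight absorbs `exp (t r²)` exactly for `t < w / 2`, leaving a Gaussian with parameter `w
    -- - 2t > 0`.
    refine ae_eq_zero_of_moments_eq_zero (X := fun r => r ^ 2) (g := Real.sqrt) (δ := w / 2)
      (by fun_prop) (by fun_prop) ?_ (half_pos hw) (hcont.aemeasurable measurableSet_Ioi) ?_ ?_
    · filter_upwards [ae_restrict_mem measurableSet_Ioi] with r hr
      exact Real.sqrt_sq (le_of_lt hr)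
    · intro t ht
      refine (integrableOn_mul_gaussPow hL (w := w - 2 * t) (s := m + 1 / 2) (by linarith)
        (by linarith)).congr (ae_of_all _ fun r => ?_)
      simp only [gaussPow, mul_assoc, ← Real.exp_add]
      congr 3
      ring
    · intro n
      refine Eq.trans ?_ (hmom n)
      refine setIntegral_congr_fun measurableSet_Ioi fun r hr => ?_
      simp only [gaussPow_add_two_mul_nat w (m + 1 / 2) n hr]
      ring
  have := Measure.eqOn_open_of_ae_eq hae isOpen_Ioi hcont continuousOn_const
  intro r hr
  have h0 := this hr
  exact (mul_eq_zero.mp h0).resolve_right (gaussPow_pos w (m + 1 / 2) hr).ne'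

end RadialSolution

/-! ### Laguerre eigenfunctions -/

/-- The coefficients of the `k`-th (unnormalized) Laguerre polynomial in the variable `w r²`. -/
def laguerreCoeff (m w : ℝ) (k : ℕ) : ℕ → ℝ
  | 0 => 1
  | j + 1 => w * (j - k) / ((j + 1) * (j + 1 + m)) * laguerreCoeff m w k j

/-- The `k`-th oscillator eigenfunction. -/
def eigenfunction (m w : ℝ) (k : ℕ) (r : ℝ) : ℝ :=
  ∑ j ∈ Finset.range (k + 1), laguerreCoeff m w k j * gaussPow w (m + 1 / 2 + 2 * j) r

/-- The derivative of `eigenfunction m w k` on the half line. -/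
def eigenfunctionDeriv (m w : ℝ) (k : ℕ) (r : ℝ) : ℝ :=
  ∑ j ∈ Finset.range (k + 1), laguerreCoeff m w k j * gaussPowDeriv w (m + 1 / 2 + 2 * j) r

lemma isRadialSolution_eigenfunction {m : ℝ} (hm : 0 ≤ m) (w : ℝ) (k : ℕ) :
    IsRadialSolution m w (w * (m + 1 + 2 * k)) (eigenfunction m w k)
      (eigenfunctionDeriv m w k) where
  hasDerivAt r hr := HasDerivAt.fun_sum fun j _ => (hasDerivAt_gaussPow w _ hr).const_mul _
  hasDerivAt_deriv r hr := by
    refine (HasDerivAt.fun_sum fun (j : ℕ) _ =>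
      (hasDerivAt_gaussPowDeriv w (m + 1 / 2 + 2 * j) hr).const_mul
        (laguerreCoeff m w k j)).congr_deriv ?_
    -- The coefficient recursion makes the defect of the equation telescope. `T 0` vanishes by its
    -- factor `j`, and `T (k + 1)` by the factor `j - k` in the recursion at `j = k`, which
    -- terminates the series.
    let T : ℕ → ℝ := fun j =>
      4 * j * (j + m) * laguerreCoeff m w k j * gaussPow w (m + 1 / 2 + 2 * j - 2) r
    have hT : ∑ j ∈ Finset.range (k + 1), (T j - T (j + 1)) = 0 := by
      rw [Finset.sum_range_sub']
      simp [T, laguerreCoeff]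
    rw [eigenfunction, Finset.mul_sum, ← sub_eq_zero, ← Finset.sum_sub_distrib, ← hT]
    refine Finset.sum_congr rfl fun j _ => ?_
    have hT1 : T (j + 1) = 4 * w * (j - k) * laguerreCoeff m w k j *
        gaussPow w (m + 1 / 2 + 2 * j) r := by
      have h1 : (j : ℝ) + 1 ≠ 0 := by positivity
      have h2 : (j : ℝ) + 1 + m ≠ 0 := by positivity
      simp only [T, laguerreCoeff]
      rw [show m + 1 / 2 + 2 * ((j + 1 : ℕ) : ℝ) - 2 = m + 1 / 2 + 2 * j by push_cast; ring]
      push_cast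
      field_simp
    rw [hT1]
    simp only [T]
    set s := m + 1 / 2 + 2 * (j : ℝ) with hs
    have e1 : gaussPow w s r = r ^ 2 * gaussPow w (s - 2) r := by
      have := gaussPow_add w (s - 2) 2 hr
      rw [sub_add_cancel] at this
      rw [this]; norm_num
    have e2 : (m ^ 2 - 1 / 4) / r ^ 2 * gaussPow w s r =
        (m ^ 2 - 1 / 4) * gaussPow w (s - 2) r := by
      rw [e1]; field_simp
    have e4 : (m ^ 2 - 1 / 4) - s * (s - 1) = -(4 * j * (j + m)) := by rw [hs]; ring
    have e5 : w * (2 * s + 1) = 2 * w * (m + 1 + 2 * j) := by rw [hs]; ring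
    linear_combination (-laguerreCoeff m w k j) * e2
      - laguerreCoeff m w k j * gaussPow w (s - 2) r * e4
      - laguerreCoeff m w k j * gaussPow w s r * e5

lemma memLp_eigenfunction {m w : ℝ} (hm : 0 ≤ m) (hw : 0 < w) (k : ℕ) :
    MemLp (eigenfunction m w k) 2 (volume.restrict (Ioi (0 : ℝ))) :=
  memLp_finsetSum _ fun j _ => (memLp_gaussPow hw (by
    have : (0 : ℝ) ≤ j := j.cast_nonneg
    linarith)).const_mul _

lemma contDiffOn_eigenfunction (m w : ℝ) (k : ℕ) :
    ContDiffOn ℝ 2 (eigenfunction m w k) (Ioi 0) := by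
  refine ContDiffOn.sum fun j _ => contDiffOn_const.mul (ContDiffOn.mul ?_ ?_)
  · exact contDiffOn_id.rpow_const_of_ne fun r hr => ne_of_gt hr
  · exact (contDiff_const.mul (contDiff_id.pow 2)).exp.contDiffOn

/-- Isolates the power at the origin: the other factor is continuous with value `1` at `0`, which
gives both regularity and nonvanishing. -/
lemma eigenfunction_eq (m w : ℝ) (k : ℕ) {r : ℝ} (hr : 0 < r) :
    eigenfunction m w k r = r ^ (m + 1 / 2) * (Real.exp (-(w / 2) * r ^ 2) *
      ∑ j ∈ Finset.range (k + 1), laguerreCoeff m w k j * (r ^ 2) ^ j) := by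
  rw [← mul_assoc, eigenfunction, Finset.mul_sum]
  refine Finset.sum_congr rfl fun j _ => ?_
  rw [gaussPow_add_two_mul_nat w _ j hr, gaussPow]
  ring

lemma continuous_laguerre_sum (m w : ℝ) (k : ℕ) : Continuous fun r : ℝ =>
    Real.exp (-(w / 2) * r ^ 2) *
      ∑ j ∈ Finset.range (k + 1), laguerreCoeff m w k j * (r ^ 2) ^ j := by
  fun_prop

lemma isBigO_eigenfunction (m w : ℝ) (k : ℕ) :
    eigenfunction m w k =O[𝓝[>] (0 : ℝ)] fun r : ℝ => r ^ (m + 1 / 2) := by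
  have h1 := (((continuous_laguerre_sum m w k).tendsto 0).isBigO_one ℝ).mono
    (nhdsWithin_le_nhds (s := Ioi 0))
  have h2 := (isBigO_refl (fun r : ℝ => r ^ (m + 1 / 2)) (𝓝[>] 0)).mul h1
  simp only [mul_one] at h2
  refine h2.congr' ?_ EventuallyEq.rfl
  filter_upwards [self_mem_nhdsWithin] with r hr
  exact (eigenfunction_eq m w k hr).symm

lemma exists_eigenfunction_ne_zero (m w : ℝ) (k : ℕ) :
    ∃ r : ℝ, 0 < r ∧ eigenfunction m w k r ≠ 0 := by
  have h := (continuous_laguerre_sum m w k).tendsto 0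
  have h0 : Real.exp (-(w / 2) * (0 : ℝ) ^ 2) *
      ∑ j ∈ Finset.range (k + 1), laguerreCoeff m w k j * ((0 : ℝ) ^ 2) ^ j = 1 := by
    rw [Finset.sum_eq_single 0] <;> simp +contextual [laguerreCoeff]
  rw [h0] at h
  have h1 := (h.mono_left (nhdsWithin_le_nhds (s := Ioi 0))).eventually_ne one_ne_zero
  obtain ⟨r, hr, hr0⟩ := (h1.and self_mem_nhdsWithin).exists
  refine ⟨r, hr0, ?_⟩
  rw [eigenfunction_eq m w k hr0]
  exact mul_ne_zero (Real.rpow_pos_of_pos hr0 _).ne' hr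

/-! ### Back to the Schrödinger equation -/

lemma two_mul_effectivePotential {l : ℕ} {Lam A₁ : ℝ} (lam : ℝ) (hA₁ : A₁ < 0)
    (hLam : -((l : ℝ) + 1 / 2) ^ 2 ≤ Lam) {r : ℝ} (hr : 0 < r) :
    2 * effectivePotential l Lam lam A₁ r =
      (originIndex l Lam ^ 2 - 1 / 4) / r ^ 2 + (2 * lam ^ 2 * Real.sqrt (-A₁)) ^ 2 * r ^ 2 := by
  rw [effectivePotential, originIndex, Real.sq_sqrt (by linarith), mul_pow,
    Real.sq_sqrt (by linarith)]
  field_simp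
  ring

lemma isBoundState_eigenfunction (l : ℕ) {Lam lam A₁ : ℝ} (hlam : 0 < lam) (hA₁ : A₁ < 0)
    (hLam : -((l : ℝ) + 1 / 2) ^ 2 ≤ Lam) (k : ℕ) :
    IsBoundState l Lam lam A₁
      (2 * lam ^ 2 * Real.sqrt (-A₁) * (originIndex l Lam + 1 + 2 * k))
      (fun r => (eigenfunction (originIndex l Lam) (2 * lam ^ 2 * Real.sqrt (-A₁)) k r : ℂ)) := by
  have hw : 0 < 2 * lam ^ 2 * Real.sqrt (-A₁) := by
    have := Real.sqrt_pos.mpr (neg_pos.mpr hA₁)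
    positivity
  have hpot := fun r (hr : 0 < r) => two_mul_effectivePotential lam hA₁ hLam hr
  set w := 2 * lam ^ 2 * Real.sqrt (-A₁)
  set m := originIndex l Lam
  have hm : 0 ≤ m := Real.sqrt_nonneg _
  have hsol := isRadialSolution_eigenfunction hm w k
  refine ⟨?_, fun r hr => ?_, ?_, (memLp_eigenfunction hm hw k).ofReal, fun _ => ?_⟩
  · exact Complex.ofRealCLM.contDiff.comp_contDiffOn (contDiffOn_eigenfunction m w k)
  · have hd : deriv (fun r => (eigenfunction m w k r : ℂ)) =ᶠ[𝓝 r]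
        fun r => (eigenfunctionDeriv m w k r : ℂ) := by
      filter_upwards [Ioi_mem_nhds hr] with x hx
      exact (hsol.hasDerivAt x hx).ofReal_comp.deriv
    rw [hd.deriv_eq, (hsol.hasDerivAt_deriv r hr).ofReal_comp.deriv]
    have := hpot r hr
    rw [show effectivePotential l Lam lam A₁ r =
      ((m ^ 2 - 1 / 4) / r ^ 2 + w ^ 2 * r ^ 2) / 2 by linarith]
    push_cast
    ring
  · obtain ⟨r, hr, h⟩ := exists_eigenfunction_ne_zero m w k
    exact ⟨r, hr, Complex.ofReal_ne_zero.mpr h⟩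
  · refine IsBigO.of_norm_left ?_
    simp only [Complex.norm_real]
    exact (isBigO_eigenfunction m w k).norm_left

/-- The equation has real coefficients, so real-linear functionals preserve it; the real and
imaginary parts are the cases needed. -/
lemma IsBoundState.isRadialSolution {l : ℕ} {Lam lam A₁ E : ℝ} {ψ : ℝ → ℂ}
    (h : IsBoundState l Lam lam A₁ E ψ) (hA₁ : A₁ < 0)
    (hLam : -((l : ℝ) + 1 / 2) ^ 2 ≤ Lam) (L : ℂ →L[ℝ] ℝ) :
    IsRadialSolution (originIndex l Lam) (2 * lam ^ 2 * Real.sqrt (-A₁)) E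
      (fun r => L (ψ r)) (fun r => L (deriv ψ r)) := by
  have h1 := (contDiffOn_succ_iff_deriv_of_isOpen (n := 1) isOpen_Ioi).mp
    (show ContDiffOn ℝ (1 + 1) ψ (Ioi 0) by rw [one_add_one_eq_two]; exact h.contDiffOn)
  refine ⟨fun r hr => ?_, fun r hr => ?_⟩
  · exact L.hasFDerivAt.comp_hasDerivAt r
      ((h1.1 r hr).differentiableAt (Ioi_mem_nhds hr)).hasDerivAt
  · have hd := L.hasFDerivAt.comp_hasDerivAt r
      ((h1.2.2.differentiableOn one_ne_zero r hr).differentiableAt (Ioi_mem_nhds hr)).hasDerivAt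
    refine hd.congr_deriv ?_
    have heq : deriv (deriv ψ) r = (2 * effectivePotential l Lam lam A₁ r - 2 * E) • ψ r := by
      rw [Complex.real_smul]
      push_cast
      linear_combination (-2) * h.schrodinger r hr
    rw [heq, map_smul, two_mul_effectivePotential lam hA₁ hLam hr, smul_eq_mul]

lemma IsBoundState.exists_energy_eq {l : ℕ} {Lam lam A₁ E : ℝ} {ψ : ℝ → ℂ}
    (h : IsBoundState l Lam lam A₁ E ψ) (hlam : 0 < lam) (hA₁ : A₁ < 0)
    (hLam : -((l : ℝ) + 1 / 2) ^ 2 ≤ Lam) :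
    ∃ k : ℕ, E = 2 * lam ^ 2 * Real.sqrt (-A₁) * (originIndex l Lam + 1 + 2 * k) := by
  have hw : 0 < 2 * lam ^ 2 * Real.sqrt (-A₁) := by
    have := Real.sqrt_pos.mpr (neg_pos.mpr hA₁)
    positivity
  by_contra! hne
  have hz : ∀ L : ℂ →L[ℝ] ℝ, ∀ r, 0 < r → L (ψ r) = 0 := fun L =>
    (h.isRadialSolution hA₁ hLam L).eq_zero (Real.sqrt_nonneg _) hw (L.comp_memLp' h.memLp)
      (fun hm => (L.isBigO_comp ψ _).trans (h.regular hm)) hne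
  obtain ⟨r, hr, hψ⟩ := h.ne_zero
  exact hψ (Complex.ext (hz Complex.reCLM r hr) (hz Complex.imCLM r hr))

end SingularOscillator

end

theorem mainTheorem8 (l : ℕ) (Lam lam A₁ : ℝ) (hlam : 0 < lam) (hA₁ : A₁ < 0)
    (hLam : -((l : ℝ) + 1 / 2) ^ 2 ≤ Lam) :
    SingularOscillator.boundStateEnergies l Lam lam A₁ =
      Set.range fun k : ℕ =>
        4 * lam ^ 2 * Real.sqrt (-A₁) *
          ((k : ℝ) + 1 / 2 + 1 / 2 * Real.sqrt (Lam + ((l : ℝ) + 1 / 2) ^ 2)) := by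
  have henergy : ∀ k : ℕ, 4 * lam ^ 2 * Real.sqrt (-A₁) *
      ((k : ℝ) + 1 / 2 + 1 / 2 * Real.sqrt (Lam + ((l : ℝ) + 1 / 2) ^ 2)) =
      2 * lam ^ 2 * Real.sqrt (-A₁) * (SingularOscillator.originIndex l Lam + 1 + 2 * k) := by
    intro k
    rw [SingularOscillator.originIndex]
    ring
  ext E
  constructor
  · rintro ⟨ψ, hψ⟩
    obtain ⟨k, hk⟩ := hψ.exists_energy_eq hlam hA₁ hLam
    exact ⟨k, (henergy k).trans hk.symm⟩
  · rintro ⟨k, rfl⟩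
    have := SingularOscillator.isBoundState_eigenfunction l hlam hA₁ hLam k
    rw [← henergy k] at this
    exact ⟨_, this⟩
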